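/- Let $k$ be an algebraically closed field of characteristic $p>0$, and let $\mathbb{G}_a\rtimes\mathbb{G}_m$ have the product $(t_1,z_1)(t_2,z_2)=(t_1+z_1^2t_2,\,z_1z_2)$. Let $\iota:\mathbb{G}_a\rtimes\mathbb{G}_m\to\mathrm{SL}(2,k)$, $\iota(t,z)=\begin{pmatrix}z&tz^{-1}\\0&z^{-1}\end{pmatrix}$, and use $\iota$ to identify $\mathbb{G}_a\rtimes\mathbb{G}_m$ with the group of upper triangular matrices $\begin{pmatrix}a&b\\0&d\end{pmatrix}$ of $\mathrm{SL}(2,k)$. Representations are homomorphisms of algebraic groups over $k$. Two homomorphisms $\rho_1,\rho_2:G\to\mathrm{SL}(n,k)$ are equivalent if there is $P\in\mathrm{GL}(n,k)$ with $P^{-1}\rho_1(g)P=\rho_2(g)$ for all $g\in G$. A representation $\varphi:\mathbb{G}_a\rtimes\mathbb{G}_m\to\mathrm{SL}(n,k)$ is fundamental if there is a representation $\psi:\mathrm{SL}(2,k)\to\mathrm{SL}(n,k)$ with $\psi\circ\iota=\varphi$; such a $\psi$ is called an extension of $\varphi$. Put $h_\varphi(z):=\varphi(0,z)$ for $z\in\mathbb{G}_m$.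 Consider the following forms of a homomorphism $\varphi:\mathbb{G}_a\rtimes\mathbb{G}_m\to\mathrm{SL}(3,k)$, where $e\ge 0$ is an integer and the matrix is the value of $\varphi$ at $\begin{pmatrix}a&b\\0&d\end{pmatrix}$: - (I)$^\sharp$, for $p\ge3$: $\begin{pmatrix}a^{2p^e}&a^{p^e}b^{p^e}&\tfrac12b^{2p^e}\\0&1&b^{p^e}d^{p^e}\\0&0&d^{2p^e}\end{pmatrix}$; - (IV)$^\sharp$, for $p\ge2$: $\begin{pmatrix}a^{p^e}&0&b^{p^e}\\0&1&0\\0&0&d^{p^e}\end{pmatrix}$; - (V)$^\sharp$, for $p=2$: $\begin{pmatrix}a^{2p^e}&a^{p^e}b^{p^e}&b^{2p^e}\\0&1&0\\0&0&d^{2p^e}\end{pmatrix}$; - (VII)$^\sharp$, for $p=2$: $\begin{pmatrix}a^{2p^e}&0&b^{2p^e}\\0&1&b^{p^e}d^{p^e}\\0&0&d^{2p^e}\end{pmatrix}$; - (XII)$^\sharp$, for $p\ge2$: the identity matrix $I_3$. Let $\Lambda^\sharp$ be the set of these five names, and for $\lambda\in\Lambda^\sharp$ let $R^\sharp(\lambda)$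 be the set of all fundamental representations $\mathbb{G}_a\rtimes\mathbb{G}_m\to\mathrm{SL}(3,k)$ of the form $\lambda$, for some $e\ge0$ (it is empty if $p$ is excluded for $\lambda$). Then: (0) Every form allowed for $p$, with any $e\ge0$, defines a representation of $\mathbb{G}_a\rtimes\mathbb{G}_m$ into $\mathrm{SL}(3,k)$, and this has exactly one extension to a representation of $\mathrm{SL}(2,k)$ into $\mathrm{SL}(3,k)$; in particular it is fundamental. (1) Every fundamental representation $\mathbb{G}_a\rtimes\mathbb{G}_m\to\mathrm{SL}(3,k)$ is equivalent to an element of $R^\sharp(\lambda)$ for some $\lambda\in\Lambda^\sharp$. (2) Let $\phi\in R^\sharp(\lambda)$ and $\psi\in R^\sharp(\mu)$, where $\lambda,\mu\in\Lambda^\sharp$. Then there are integers $\ell_i,m_i$ with $h_\phi(z)=\mathrm{diag}(z^{\ell_1},z^{\ell_2},z^{\ell_3})$ and $h_\psi(z)=\mathrm{diag}(z^{m_1},z^{m_2},z^{m_3})$ for all $z\in\mathbb{G}_m$, and for any such integers: (2.1) If $\lambda\ne\mu$, then $\phi$ and $\psi$ are not equivalent. (2.2) If $\lambda=\mu$, then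 the following are equivalent: (i) $\phi$ and $\psi$ are equivalent; (ii) $h_\phi$ and $h_\psi$ are equivalent; (iii) $(\ell_1,\ell_2,\ell_3)=(m_1,m_2,m_3)$; (iv) $\phi=\psi$. -/

import Mathlib

namespace AlgRep

/-- A regular function on the affine variety of points `G`, embedded by the coordinates `x` in
affine space: the restriction of a polynomial in the coordinates. -/
def IsRegular {k : Type*} [Field k] {G ι : Type*} (x : G → ι → k) (f : G → k) : Prop :=
  ∃ F : MvPolynomial ι k, ∀ g, f g = MvPolynomial.eval (x g) F

/-- A representation, as algebraic group, of `G` (with coordinates `x`) into `SL(n, k)`: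
a group homomorphism that is a morphism of affine varieties. -/
def IsRep {k : Type*} [Field k] {G ι : Type*} [Group G] (x : G → ι → k) {n : ℕ}
    (ρ : G →* Matrix.SpecialLinearGroup (Fin n) k) : Prop :=
  ∀ i j, IsRegular x (fun g => (ρ g).1 i j)

/-- Equivalence of representations into `SL(n, k)`: conjugation by a matrix of `GL(n, k)`. -/
def Equivalent {k : Type*} [Field k] {G : Type*} [Group G] {n : ℕ}
    (ρ₁ ρ₂ : G →* Matrix.SpecialLinearGroup (Fin n) k) : Prop :=
  ∃ P : Matrix.GeneralLinearGroup (Fin n) k, ∀ g,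
    (P⁻¹).1 * (ρ₁ g).1 * P.1 = (ρ₂ g).1

/-- The action `σ_z(t) = z² t` of `𝔾_m` on `𝔾_a`. -/
def sigma (k : Type*) [Field k] : kˣ →* MulAut (Multiplicative k) where
  toFun z :=
    { toFun := fun t => Multiplicative.ofAdd ((z : k) ^ 2 * t.toAdd)
      invFun := fun t => Multiplicative.ofAdd (((z⁻¹ : kˣ) : k) ^ 2 * t.toAdd)
      left_inv := fun t => by
        change (((z⁻¹ : kˣ) : k) ^ 2 * ((z : k) ^ 2 * t.toAdd)) = t.toAdd
        rw [← mul_assoc, ← mul_pow, Units.inv_mul, one_pow, one_mul]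
      right_inv := fun t => by
        change ((z : k) ^ 2 * (((z⁻¹ : kˣ) : k) ^ 2 * t.toAdd)) = t.toAdd
        rw [← mul_assoc, ← mul_pow, Units.mul_inv, one_pow, one_mul]
      map_mul' := fun s t => by
        simp [mul_add] }
  map_one' := by
    ext t
    simp
  map_mul' z w := by
    ext t
    simp [mul_pow, mul_assoc]

/-- The group `𝔾_a ⋊ 𝔾_m`, with `(t₁, z₁) (t₂, z₂) = (t₁ + z₁² t₂, z₁ z₂)`. -/
abbrev GaGm (k : Type*) [Field k] : Type _ := Multiplicative k ⋊[sigma k] kˣ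

/-- The coordinates `t, z, z⁻¹` of `𝔾_a ⋊ 𝔾_m`. -/
def coordGaGm (k : Type*) [Field k] (g : GaGm k) : Fin 3 → k :=
  ![g.left.toAdd, (g.right : k), ((g.right⁻¹ : kˣ) : k)]

/-- The coordinates of `SL(2, k)`: the matrix entries. -/
def coordSL2 (k : Type*) [Field k] (g : Matrix.SpecialLinearGroup (Fin 2) k) :
    Fin 2 × Fin 2 → k :=
  fun ij => g.1 ij.1 ij.2

/-- The matrix `ι(t, z) = (z, t z⁻¹; 0, z⁻¹)`. -/
def iotaMatrix (k : Type*) [Field k] (g : GaGm k) : Matrix (Fin 2) (Fin 2) k :=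
  !![(g.right : k), g.left.toAdd * ((g.right⁻¹ : kˣ) : k);
     0, ((g.right⁻¹ : kˣ) : k)]

theorem iotaMatrix_det (k : Type*) [Field k] (g : GaGm k) : (iotaMatrix k g).det = 1 := by
  simp [iotaMatrix, Matrix.det_fin_two]

theorem iotaMatrix_one (k : Type*) [Field k] : iotaMatrix k 1 = 1 := by
  simp [iotaMatrix, Matrix.one_fin_two]

theorem iotaMatrix_mul (k : Type*) [Field k] (g h : GaGm k) :
    iotaMatrix k (g * h) = iotaMatrix k g * iotaMatrix k h := by
  have hg : (g.right : k) ≠ 0 := g.right.ne_zero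
  have hh : (h.right : k) ≠ 0 := h.right.ne_zero
  have e : ((g * h).left).toAdd = g.left.toAdd + (g.right : k) ^ 2 * h.left.toAdd := rfl
  unfold iotaMatrix
  rw [e, Matrix.mul_fin_two]
  ext i j
  fin_cases i <;> fin_cases j <;> simp <;> field_simp
  ring

/-- The embedding `ι` of `𝔾_a ⋊ 𝔾_m` in `SL(2, k)`. -/
def iota (k : Type*) [Field k] : GaGm k →* Matrix.SpecialLinearGroup (Fin 2) k where
  toFun g := (⟨iotaMatrix k g, iotaMatrix_det k g⟩ : Matrix.SpecialLinearGroup (Fin 2) k)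
  map_one' := Subtype.ext (iotaMatrix_one k)
  map_mul' g h := Subtype.ext (iotaMatrix_mul k g h)

/-- `ψ` is a representation of `SL(2, k)` that extends `φ`. -/
def IsExtension {k : Type*} [Field k] {n : ℕ} (φ : GaGm k →* Matrix.SpecialLinearGroup (Fin n) k)
    (ψ : Matrix.SpecialLinearGroup (Fin 2) k →* Matrix.SpecialLinearGroup (Fin n) k) : Prop :=
  IsRep (coordSL2 k) ψ ∧ ψ.comp (iota k) = φ

/-- `φ` is a fundamental representation of `𝔾_a ⋊ 𝔾_m`. -/
def IsFundamental {k : Type*} [Field k] {n : ℕ}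
    (φ : GaGm k →* Matrix.SpecialLinearGroup (Fin n) k) : Prop :=
  IsRep (coordGaGm k) φ ∧ ∃ ψ, IsExtension φ ψ

/-- The homomorphism `h_φ(z) = φ(0, z)`, that is, `φ` at the diagonal matrix `(z, z⁻¹)`. -/
def torusPart {k : Type*} [Field k] {n : ℕ} (φ : GaGm k →* Matrix.SpecialLinearGroup (Fin n) k) :
    kˣ →* Matrix.SpecialLinearGroup (Fin n) k :=
  φ.comp SemidirectProduct.inr

/-- `h(z) = diag(z^ℓ₁, …, z^ℓₙ)` for all `z`. -/
def HasWeights {k : Type*} [Field k] {n : ℕ} (h : kˣ →* Matrix.SpecialLinearGroup (Fin n) k)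
    (ℓ : Fin n → ℤ) : Prop :=
  ∀ z, (h z).1 = Matrix.diagonal (fun i => (z : k) ^ ℓ i)

/-- The set `Λ♯` of names of forms. -/
inductive SharpForm
  | I | IV | V | VII | XII

/-- The characteristics in which a form is considered. -/
def SharpForm.Admissible (p : ℕ) : SharpForm → Prop
  | .I => 3 ≤ p
  | .IV => 2 ≤ p
  | .V => p = 2
  | .VII => p = 2
  | .XII => 2 ≤ p

/-- The matrix that the form gives, with exponent `e`, at the matrix `(a, b; 0, d)`. -/
def SharpForm.matrix {k : Type*} [Field k] (p e : ℕ) (a b d : k) :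
    SharpForm → Matrix (Fin 3) (Fin 3) k
  | .I => !![a ^ (2 * p ^ e), a ^ p ^ e * b ^ p ^ e, 1 / 2 * b ^ (2 * p ^ e);
             0, 1, b ^ p ^ e * d ^ p ^ e;
             0, 0, d ^ (2 * p ^ e)]
  | .IV => !![a ^ p ^ e, 0, b ^ p ^ e;
              0, 1, 0;
              0, 0, d ^ p ^ e]
  | .V => !![a ^ (2 * p ^ e), a ^ p ^ e * b ^ p ^ e, b ^ (2 * p ^ e);
             0, 1, 0;
             0, 0, d ^ (2 * p ^ e)]
  | .VII => !![a ^ (2 * p ^ e), 0, b ^ (2 * p ^ e);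
               0, 1, b ^ p ^ e * d ^ p ^ e;
               0, 0, d ^ (2 * p ^ e)]
  | .XII => !![1, 0, 0;
               0, 1, 0;
               0, 0, 1]

/-- `φ` is given by the form `lam` with exponent `e`, under the identification of
`𝔾_a ⋊ 𝔾_m` with the upper triangular matrices `(a, b; 0, d)` of `SL(2, k)`. -/
def IsGivenBy {k : Type*} [Field k] (p e : ℕ) (lam : SharpForm)
    (φ : GaGm k →* Matrix.SpecialLinearGroup (Fin 3) k) : Prop :=
  ∀ g, (φ g).1 = lam.matrix p e ((iota k g).1 0 0) ((iota k g).1 0 1) ((iota k g).1 1 1)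

/-- The set `R♯(lam)` of fundamental representations with the form `lam`. -/
def R (k : Type*) [Field k] (p : ℕ) (lam : SharpForm) :
    Set (GaGm k →* Matrix.SpecialLinearGroup (Fin 3) k) :=
  {φ | IsFundamental φ ∧ lam.Admissible p ∧ ∃ e : ℕ, IsGivenBy p e lam φ}

end AlgRep

/-! The torus acts diagonalizably, so a fundamental `φ` may be conjugated to have diagonal torus
with decreasing weights. An extension `ψ` supplies a matrix `W = ψ(weyl)` that carries the torus to
its inverse. The weights are therefore symmetric, and determinant 1 makes them `(m, 0, -m)`. If `m =
0`, then `φ` is trivial.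

If `m ≠ 0`, homogeneity under `t ↦ z² t` turns the unipotent part into an upper unitriangular matrix
whose entries α, β (above the diagonal) and γ (corner) are multiplied by monomials in `t`, and `W`
is antidiagonal. The relation `weyl_braid` then expresses `W` through α, β, γ and shows γ ≠ 0
(`weyl_entries`). By the Bruhat decomposition the extension is unique.

Additivity in `t` makes the exponent of a nonzero α or β a power of `p`, and the mixed term gives
`2γ = αβ`. The vanishing of α and β separates four cases (`exists_form_unip`): both vanish (IV),
exactly one vanishes, which forces `p = 2` (V, VII), or neither vanishes, which forces `p ≠ 2` (I).
A diagonal conjugation normalizes the coefficients.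

Conversely, the forms extend by explicit matrices composed with Frobenius. Equivalent forms have the
same `m`. When `m ≠ 0` the weights are distinct, so an intertwiner is diagonal and preserves the
zero pattern of α, β, which identifies the form. -/

namespace AlgRep

open Matrix (SpecialLinearGroup GeneralLinearGroup)

/-! ### Regular functions and their pullback along `ι`. -/

section Regular

variable {k : Type*} [Field k] {G ι : Type*} {x : G → ι → k}

theorem IsRegular.const (c : k) : IsRegular x (fun _ => c) :=
  ⟨MvPolynomial.C c, fun g => by simp⟩

theorem IsRegular.coord (i : ι) : IsRegular x (fun g => x g i) :=
  ⟨MvPolynomial.X i, fun g => by simp⟩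

theorem IsRegular.add {f₁ f₂ : G → k} (h₁ : IsRegular x f₁) (h₂ : IsRegular x f₂) :
    IsRegular x (fun g => f₁ g + f₂ g) := by
  obtain ⟨F₁, h₁⟩ := h₁
  obtain ⟨F₂, h₂⟩ := h₂
  exact ⟨F₁ + F₂, fun g => by simp [h₁, h₂]⟩

theorem IsRegular.mul {f₁ f₂ : G → k} (h₁ : IsRegular x f₁) (h₂ : IsRegular x f₂) :
    IsRegular x (fun g => f₁ g * f₂ g) := by
  obtain ⟨F₁, h₁⟩ := h₁
  obtain ⟨F₂, h₂⟩ := h₂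
  exact ⟨F₁ * F₂, fun g => by simp [h₁, h₂]⟩

theorem IsRegular.pow {f : G → k} (h : IsRegular x f) (n : ℕ) :
    IsRegular x (fun g => f g ^ n) := by
  obtain ⟨F, h⟩ := h
  exact ⟨F ^ n, fun g => by simp [h]⟩

theorem IsRegular.sum {α : Type*} (s : Finset α) {f : α → G → k}
    (h : ∀ a, IsRegular x (f a)) : IsRegular x (fun g => ∑ a ∈ s, f a g) := by
  choose F hF using h
  exact ⟨∑ a ∈ s, F a, fun g => by simp [hF]⟩

/-- Regular functions pull back along maps whose coordinates are regular. -/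
theorem IsRegular.comp {H κ : Type*} {y : H → κ → k} {f : H → k} (hf : IsRegular y f)
    {θ : G → H} (hθ : ∀ j, IsRegular x (fun g => y (θ g) j)) :
    IsRegular x (fun g => f (θ g)) := by
  obtain ⟨F, hF⟩ := hf
  choose Θ hΘ using hθ
  refine ⟨MvPolynomial.bind₁ Θ F, fun g => ?_⟩
  have h : y (θ g) = fun j => MvPolynomial.eval (x g) (Θ j) := funext fun j => hΘ j g
  change f (θ g) = _
  rw [hF, h]
  exact (MvPolynomial.eval₂Hom_bind₁ (RingHom.id k) (x g) Θ F).symm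

theorem isRegular_coordSL2_iota (ij : Fin 2 × Fin 2) :
    IsRegular (coordGaGm k) (fun g => coordSL2 k (iota k g) ij) := by
  have h0 : IsRegular (coordGaGm k) (fun g => g.left.toAdd) := IsRegular.coord 0
  have h1 : IsRegular (coordGaGm k) (fun g => (g.right : k)) := IsRegular.coord 1
  have h2 : IsRegular (coordGaGm k) (fun g => ((g.right⁻¹ : kˣ) : k)) := IsRegular.coord 2
  obtain ⟨i, j⟩ := ij
  fin_cases i <;> fin_cases j
  · exact h1
  · exact h0.mul h2
  · exact IsRegular.const 0
  · exact h2

theorem IsRep.comp_iota {n : ℕ} {ψ : SpecialLinearGroup (Fin 2) k →* SpecialLinearGroup (Fin n) k}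
    (h : IsRep (coordSL2 k) ψ) : IsRep (coordGaGm k) (ψ.comp (iota k)) :=
  fun i j => (h i j).comp (θ := iota k) isRegular_coordSL2_iota

end Regular

/-! ### Conjugation and equivalence. -/

section Conj

variable {k : Type*} [Field k] {n : ℕ}

/-- Conjugation of `SL(n, k)` by an element of `GL(n, k)`. -/
def conjSL (P : GeneralLinearGroup (Fin n) k) :
    SpecialLinearGroup (Fin n) k →* SpecialLinearGroup (Fin n) k where
  toFun A := ⟨(P⁻¹).1 * A.1 * P.1, by
    rw [Matrix.det_mul, Matrix.det_mul, mul_right_comm, ← Matrix.det_mul, A.2, mul_one,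
      ← Units.val_mul, inv_mul_cancel, Units.val_one, Matrix.det_one]⟩
  map_one' := Subtype.ext (by simp)
  map_mul' A B := Subtype.ext (by
    change (P⁻¹).1 * (A.1 * B.1) * P.1 = (P⁻¹).1 * A.1 * P.1 * ((P⁻¹).1 * B.1 * P.1)
    have h : P.1 * (P⁻¹).1 = 1 := by rw [← Units.val_mul, mul_inv_cancel, Units.val_one]
    calc _ = (P⁻¹).1 * A.1 * 1 * B.1 * P.1 := by simp only [Matrix.mul_assoc, Matrix.one_mul]
      _ = _ := by rw [← h]; simp only [Matrix.mul_assoc])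

theorem IsRep.conj {G ι : Type*} [Group G] {x : G → ι → k}
    {ρ : G →* SpecialLinearGroup (Fin n) k} (h : IsRep x ρ) (P : GeneralLinearGroup (Fin n) k) :
    IsRep x ((conjSL P).comp ρ) := by
  intro i j
  change IsRegular x (fun g => ((P⁻¹).1 * (ρ g).1 * P.1) i j)
  simp only [Matrix.mul_apply]
  exact IsRegular.sum _ fun b =>
    (IsRegular.sum _ fun a => (IsRegular.const _).mul (h a b)).mul (IsRegular.const _)

theorem equivalent_conj {G : Type*} [Group G] (ρ : G →* SpecialLinearGroup (Fin n) k)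
    (P : GeneralLinearGroup (Fin n) k) : Equivalent ρ ((conjSL P).comp ρ) :=
  ⟨P, fun _ => rfl⟩

theorem Equivalent.refl {G : Type*} [Group G] (ρ : G →* SpecialLinearGroup (Fin n) k) :
    Equivalent ρ ρ :=
  ⟨1, fun g => by simp⟩

theorem Equivalent.trans {G : Type*} [Group G] {ρ₁ ρ₂ ρ₃ : G →* SpecialLinearGroup (Fin n) k}
    (h₁ : Equivalent ρ₁ ρ₂) (h₂ : Equivalent ρ₂ ρ₃) : Equivalent ρ₁ ρ₃ := by
  obtain ⟨P, hP⟩ := h₁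
  obtain ⟨Q, hQ⟩ := h₂
  refine ⟨P * Q, fun g => ?_⟩
  rw [← hQ, ← hP, mul_inv_rev, Units.val_mul, Units.val_mul]
  simp only [Matrix.mul_assoc]

theorem Equivalent.torusPart {φ ψ : GaGm k →* SpecialLinearGroup (Fin n) k}
    (h : Equivalent φ ψ) : Equivalent (torusPart φ) (torusPart ψ) := by
  obtain ⟨P, hP⟩ := h
  exact ⟨P, fun z => hP _⟩

/-- Two homomorphisms intertwined by an invertible matrix are equivalent. -/
theorem equivalent_of_intertwine {G : Type*} [Group G]
    {ρ₁ ρ₂ : G →* SpecialLinearGroup (Fin n) k} (P : GeneralLinearGroup (Fin n) k)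
    (h : ∀ g, (ρ₁ g).1 * P.1 = P.1 * (ρ₂ g).1) : Equivalent ρ₁ ρ₂ := by
  refine ⟨P, fun g => ?_⟩
  rw [Matrix.mul_assoc, h, ← Matrix.mul_assoc, ← Units.val_mul, inv_mul_cancel, Units.val_one,
    Matrix.one_mul]

theorem Equivalent.exists_intertwine {G : Type*} [Group G]
    {ρ₁ ρ₂ : G →* SpecialLinearGroup (Fin n) k} (h : Equivalent ρ₁ ρ₂) :
    ∃ P : GeneralLinearGroup (Fin n) k, ∀ g, (ρ₁ g).1 * P.1 = P.1 * (ρ₂ g).1 := by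
  obtain ⟨P, hP⟩ := h
  refine ⟨P, fun g => ?_⟩
  rw [← hP, ← Matrix.mul_assoc, ← Matrix.mul_assoc, ← Units.val_mul, mul_inv_cancel,
    Units.val_one, Matrix.one_mul]

end Conj

/-! ### Characters of the torus. -/

section Characters

variable {k : Type*} [Field k]

/-- The character `z ↦ z ^ n` of the multiplicative group. -/
def powChar (k : Type*) [Field k] (n : ℤ) : kˣ →* k :=
  (Units.coeHom k).comp (zpowGroupHom n)

theorem powChar_apply (n : ℤ) (z : kˣ) : powChar k n z = (z : k) ^ n := by
  simp [powChar]

/-- On the torus the coordinates are `0, z, z⁻¹`, so a regular function restricts to a Laurent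
polynomial. -/
theorem isRegular_torus_mem_span {f : GaGm k → k} (hf : IsRegular (coordGaGm k) f) :
    (fun z : kˣ => f (SemidirectProduct.inr z)) ∈
      Submodule.span k (Set.range fun n : ℤ => (powChar k n : kˣ → k)) := by
  set S := Submodule.span k (Set.range fun n : ℤ => (powChar k n : kˣ → k)) with hS
  have hmul : ∀ (m : ℤ) (u : kˣ → k), u ∈ S → (fun z => u z * (z : k) ^ m) ∈ S := by
    intro m u hu
    induction hu using Submodule.span_induction with
    | mem u hu =>
      obtain ⟨n, rfl⟩ := hu
      refine Submodule.subset_span ⟨n + m, funext fun z => ?_⟩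
      simp only [powChar_apply]
      rw [zpow_add₀ z.ne_zero]
    | zero =>
      convert S.zero_mem using 1
      funext z
      simp
    | add u v _ _ hu hv =>
      convert S.add_mem hu hv using 1
      funext z
      simp [add_mul]
    | smul c u _ hu =>
      convert S.smul_mem c hu using 1
      funext z
      simp [mul_assoc]
  obtain ⟨F, hF⟩ := hf
  simp only [hF]
  clear hF
  induction F using MvPolynomial.induction_on with
  | C a =>
    have h : (a • (powChar k 0 : kˣ → k)) ∈ S := S.smul_mem _ (Submodule.subset_span ⟨0, rfl⟩)
    convert h using 1
    funext z
    simp [powChar_apply]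
  | add P Q hP hQ =>
    convert S.add_mem hP hQ using 1
    funext z
    simp
  | mul_X P i hP =>
    fin_cases i
    · convert S.zero_mem using 1
      funext z
      simp [coordGaGm]
    · simpa [coordGaGm] using hmul 1 _ hP
    · simpa [coordGaGm] using hmul (-1) _ hP

variable [IsAlgClosed k]

/-- Otherwise all of the infinite group `kˣ` would consist of `d`-th roots of unity for some `d >
0`. -/
theorem zpow_injective_of_forall {m n : ℤ} (h : ∀ z : kˣ, (z : k) ^ m = (z : k) ^ n) : m = n := by
  by_contra hne
  have key : ∀ d : ℕ, 0 < d → ∃ z : kˣ, z ^ d ≠ 1 := by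
    intro d hd
    by_contra! hz
    have : NeZero d := ⟨hd.ne'⟩
    have : Infinite kˣ := by
      rw [unitsEquivNeZero.infinite_iff]
      exact (Set.finite_singleton (0 : k)).infinite_compl.to_subtype
    have hfin : Finite kˣ := Finite.of_injective
      (fun z : kˣ => (⟨z, (mem_rootsOfUnity d z).2 (hz z)⟩ : rootsOfUnity d k))
      (fun a b hab => congrArg Subtype.val hab)
    exact not_finite kˣ
  obtain ⟨z, hz⟩ := key (m - n).natAbs (by omega)
  have h1 : z ^ (m - n) = 1 := by
    rw [zpow_sub, mul_inv_eq_one]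
    ext
    simpa using h z
  apply hz
  rcases Int.natAbs_eq (m - n) with h2 | h2
  · rw [← zpow_natCast, ← h2, h1]
  · rw [← zpow_natCast, ← inv_eq_one, ← zpow_neg, ← h2, h1]

theorem linearIndependent_powChar :
    LinearIndependent k (fun n : ℤ => (powChar k n : kˣ → k)) := by
  refine (linearIndependent_monoidHom kˣ k).comp (powChar k) fun m n h => ?_
  refine zpow_injective_of_forall (k := k) fun z => ?_
  rw [← powChar_apply, h, powChar_apply]

end Characters

/-! ### Weight decomposition for the torus. -/

section Diagonalization

variable {k : Type*} [Field k] [IsAlgClosed k]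

/-- The torus part of a representation acts diagonalizably: the weight vectors span. -/
theorem weightVectors_span {n : ℕ} {φ : GaGm k →* SpecialLinearGroup (Fin n) k}
    (hφ : IsRep (coordGaGm k) φ) :
    Submodule.span k {v : Fin n → k | ∃ m : ℤ, ∀ z : kˣ,
      (torusPart φ z).1.mulVec v = (z : k) ^ m • v} = ⊤ := by
  have hc : ∀ i j, ∃ c : ℤ →₀ k, ∀ z : kˣ,
      (torusPart φ z).1 i j = c.sum fun m a => a * (z : k) ^ m := by
    intro i j
    obtain ⟨c, hc⟩ := Finsupp.mem_span_range_iff_exists_finsupp.1 (isRegular_torus_mem_span (hφ i j))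
    refine ⟨c, fun z => ?_⟩
    have h := congrFun hc z
    simp only [Finsupp.sum, Finset.sum_apply, Pi.smul_apply, powChar_apply, smul_eq_mul] at h
    exact h.symm
  choose c hc using hc
  set s : Finset ℤ := Finset.univ.biUnion fun i => Finset.univ.biUnion fun j => (c i j).support
    with hs
  have hsum : ∀ i j (z : kˣ), (torusPart φ z).1 i j = ∑ m ∈ s, c i j m * (z : k) ^ m := by
    intro i j z
    rw [hc, Finsupp.sum]
    refine Finset.sum_subset (fun m hm => ?_) fun m _ hm => ?_
    · simp only [hs, Finset.mem_biUnion, Finset.mem_univ, true_and]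
      exact ⟨i, j, hm⟩
    · rw [Finsupp.notMem_support_iff.1 hm, zero_mul]
  -- Comparing coefficients of `z ^ m` in `h(w z) = h(w) h(z)`, by independence of characters, shows
  -- that the columns of each coefficient matrix are weight vectors.
  have hw : ∀ j, ∀ m ∈ s, ∀ w : kˣ,
      (torusPart φ w).1.mulVec (fun i => c i j m) = (w : k) ^ m • fun i => c i j m := by
    intro j m hm w
    funext i
    have hlin := linearIndependent_iff'.1 (linearIndependent_powChar (k := k)) s
      (fun m => (∑ l, (torusPart φ w).1 i l * c l j m) - (w : k) ^ m * c i j m) ?_ m hm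
    · simpa [Matrix.mulVec, dotProduct] using sub_eq_zero.1 hlin
    · funext z
      have h1 : (torusPart φ (w * z)).1 i j = ∑ l, (torusPart φ w).1 i l * (torusPart φ z).1 l j := by
        rw [map_mul, Matrix.SpecialLinearGroup.coe_mul, Matrix.mul_apply]
      simp only [hsum _ _ z, hsum _ _ (w * z), Finset.mul_sum] at h1
      rw [Finset.sum_comm] at h1
      simp only [Finset.sum_apply, Pi.smul_apply, powChar_apply, smul_eq_mul, Pi.zero_apply,
        sub_mul, Finset.sum_sub_distrib, Finset.sum_mul]
      rw [sub_eq_zero]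
      refine (Eq.trans ?_ h1.symm).trans ?_
      · exact Finset.sum_congr rfl fun _ _ => Finset.sum_congr rfl fun _ _ => mul_assoc _ _ _
      · refine Finset.sum_congr rfl fun m _ => ?_
        rw [Units.val_mul, mul_zpow]
        ring
  rw [eq_top_iff, ← (Pi.basisFun k (Fin n)).span_eq, Submodule.span_le]
  rintro _ ⟨j, rfl⟩
  -- At `z = 1` the coefficient matrices sum to the identity.
  have he : Pi.basisFun k (Fin n) j = ∑ m ∈ s, fun i => c i j m := by
    funext i
    have h1 := hsum i j 1
    simp only [map_one, Matrix.SpecialLinearGroup.coe_one, Units.val_one, one_zpow, mul_one] at h1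
    rw [Finset.sum_apply, ← h1, Pi.basisFun_apply, Matrix.one_apply, Pi.single_apply]
  rw [he]
  exact Submodule.sum_mem _ fun m hm => Submodule.subset_span ⟨m, hw j m hm⟩

/-- After conjugation, the torus part is diagonal with decreasing weights. -/
theorem exists_conj_hasWeights {n : ℕ} {φ : GaGm k →* SpecialLinearGroup (Fin n) k}
    (hφ : IsRep (coordGaGm k) φ) :
    ∃ (P : GeneralLinearGroup (Fin n) k) (ℓ : Fin n → ℤ),
      HasWeights (torusPart ((conjSL P).comp φ)) ℓ ∧ Antitone ℓ := by
  obtain ⟨f, hf, hspan, hli⟩ : ∃ f : Fin n → (Fin n → k),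
      (∀ i, ∃ m : ℤ, ∀ z : kˣ, (torusPart φ z).1.mulVec (f i) = (z : k) ^ m • f i) ∧
      Submodule.span k (Set.range f) = ⊤ ∧ LinearIndependent k f := by
    have h := Submodule.exists_fun_fin_finrank_span_eq k {v : Fin n → k | ∃ m : ℤ, ∀ z : kˣ,
      (torusPart φ z).1.mulVec v = (z : k) ^ m • v}
    rw [weightVectors_span hφ, finrank_top, Module.finrank_fin_fun] at h
    exact h
  choose ℓ hℓ using hf
  set σ := Tuple.sort fun i => -ℓ i with hσ
  have hmono := Tuple.monotone_sort fun i => -ℓ i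
  have hunit : IsUnit (Matrix.of fun i j => f (σ j) i) := by
    rw [← Matrix.linearIndependent_cols_iff_isUnit]
    exact hli.comp σ σ.injective
  obtain ⟨P, hP⟩ := hunit
  refine ⟨P, ℓ ∘ σ, fun z => ?_, fun i j hij => ?_⟩
  · change (P⁻¹).1 * (torusPart φ z).1 * P.1 = _
    have h : (torusPart φ z).1 * P.1 = P.1 * Matrix.diagonal (fun i => (z : k) ^ (ℓ ∘ σ) i) := by
      ext i j
      have h1 := congrFun (hℓ (σ j) z) i
      rw [Matrix.mul_diagonal, hP, Matrix.mul_apply]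
      simpa [Matrix.mulVec, dotProduct, mul_comm] using h1
    rw [Matrix.mul_assoc, h, ← Matrix.mul_assoc, ← Units.val_mul, inv_mul_cancel, Units.val_one,
      Matrix.one_mul]
  · have := hmono hij
    simpa using this

end Diagonalization

/-! ### The unipotent part: homogeneous and additive polynomials. -/

section Unipotent

variable {k : Type*} [Field k]

/-- The element `(t, 1)` of `𝔾_a ⋊ 𝔾_m`. -/
def unip (k : Type*) [Field k] (t : k) : GaGm k := SemidirectProduct.inl (Multiplicative.ofAdd t)

theorem unip_add (s t : k) : unip k (s + t) = unip k s * unip k t := by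
  simp [unip, ofAdd_add]

theorem unip_zero : unip k 0 = 1 := by
  simp [unip]

theorem eq_unip_mul_inr (g : GaGm k) : g = unip k g.left.toAdd * SemidirectProduct.inr g.right :=
  (SemidirectProduct.inl_left_mul_inr_right g).symm

theorem inr_mul_unip (z : kˣ) (t : k) :
    SemidirectProduct.inr z * unip k t = unip k ((z : k) ^ 2 * t) * SemidirectProduct.inr z := by
  refine SemidirectProduct.ext ?_ ?_
  · change (1 : Multiplicative k) * sigma k z (Multiplicative.ofAdd t) =
      Multiplicative.ofAdd ((z : k) ^ 2 * t) * sigma k 1 1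
    rw [map_one, one_mul]
    simp [sigma]
  · simp [unip]

theorem exists_polynomial_unip {f : GaGm k → k} (hf : IsRegular (coordGaGm k) f) :
    ∃ F : Polynomial k, ∀ t, f (unip k t) = F.eval t := by
  obtain ⟨F, hF⟩ := hf
  refine ⟨MvPolynomial.aeval ![Polynomial.X, 1, 1] F, fun t => ?_⟩
  rw [hF]
  have h : coordGaGm k (unip k t) = ![t, 1, 1] := by
    simp [coordGaGm, unip]
  rw [h]
  clear hF h
  induction F using MvPolynomial.induction_on with
  | C a => simp
  | add P Q hP hQ => simp [hP, hQ]
  | mul_X P i hP =>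
    rw [map_mul, map_mul, hP, Polynomial.eval_mul]
    congr 1
    fin_cases i <;> simp

variable [IsAlgClosed k]

theorem polynomial_eq_of_forall_units {F G : Polynomial k}
    (h : ∀ z : kˣ, F.eval (z : k) = G.eval (z : k)) : F = G := by
  have h1 : Polynomial.X * F = Polynomial.X * G := by
    refine Polynomial.funext fun z => ?_
    rcases eq_or_ne z 0 with rfl | hz
    · simp
    · simpa [hz] using h (Units.mk0 z hz)
  exact mul_left_cancel₀ Polynomial.X_ne_zero h1

/-- A polynomial function that is homogeneous for `t ↦ z² t` is a monomial. -/
theorem eval_eq_monomial_of_homogeneous {F : Polynomial k} {d : ℤ}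
    (h : ∀ z : kˣ, F.eval ((z : k) ^ 2) = (z : k) ^ d * F.eval 1) (h0 : F.eval 1 ≠ 0) :
    ∃ n : ℕ, d = 2 * n ∧ ∀ t, F.eval t = F.eval 1 * t ^ n := by
  have hX : ∀ z : k, (Polynomial.expand k 2 F).eval z = F.eval (z ^ 2) := fun z => by
    rw [Polynomial.expand_eval]
  have hd : ∃ m : ℕ, d = m := by
    refine ⟨d.toNat, (Int.toNat_of_nonneg ?_).symm⟩
    by_contra! hneg
    -- For `d < 0` the left side vanishes at 0, against `F(1) ≠ 0`.
    have hp : Polynomial.X ^ (-d).toNat * Polynomial.expand k 2 F = Polynomial.C (F.eval 1) := by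
      refine polynomial_eq_of_forall_units fun z => ?_
      rw [Polynomial.eval_mul, hX, h, Polynomial.eval_pow, Polynomial.eval_X, Polynomial.eval_C,
        ← zpow_natCast, Int.toNat_of_nonneg (by omega), ← mul_assoc, ← zpow_add₀ z.ne_zero,
        neg_add_cancel, zpow_zero, one_mul]
    have h1 := congrArg (Polynomial.eval 0) hp
    rw [Polynomial.eval_mul, Polynomial.eval_pow, Polynomial.eval_X, zero_pow (by omega), zero_mul,
      Polynomial.eval_C] at h1
    exact h0 h1.symm
  obtain ⟨m, rfl⟩ := hd
  have hp : Polynomial.expand k 2 F = Polynomial.C (F.eval 1) * Polynomial.X ^ m := by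
    refine polynomial_eq_of_forall_units fun z => ?_
    rw [hX, h, zpow_natCast, Polynomial.eval_mul, Polynomial.eval_C, Polynomial.eval_pow,
      Polynomial.eval_X, mul_comm]
  -- Only even powers occur in `F(X²)`.
  have hm : 2 ∣ m := by
    by_contra hm
    have h1 := congrArg (fun Q => Polynomial.coeff Q m) hp
    simp only [Polynomial.coeff_C_mul, Polynomial.coeff_X_pow, if_pos, mul_one] at h1
    rw [Polynomial.coeff_expand two_pos, if_neg hm] at h1
    exact h0 h1.symm
  obtain ⟨n, rfl⟩ := hm
  refine ⟨n, by push_cast; ring, fun t => ?_⟩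
  obtain ⟨z, rfl⟩ := IsAlgClosed.exists_pow_nat_eq t two_pos
  rw [← hX, hp]
  simp [pow_mul]

/-- Write `n = p ^ e * r` with `p ∤ r`. Injectivity of Frobenius passes the identity to `r`; if `r ≠
1`, the linear coefficient gives `r = 0` in `k`, a contradiction. -/
theorem exists_eq_pow_of_additive {p n : ℕ} (hp : p.Prime) [CharP k p] (hn : n ≠ 0)
    (h : ∀ t : k, (1 + t) ^ n = 1 + t ^ n) : ∃ e : ℕ, n = p ^ e := by
  have : Fact p.Prime := ⟨hp⟩
  have : ExpChar k p := ExpChar.prime hp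
  obtain ⟨e, r, hr, rfl⟩ := Nat.exists_eq_pow_mul_and_not_dvd hn p hp.ne_one
  have h1 : ∀ t : k, (1 + t) ^ r = 1 + t ^ r := by
    intro t
    have h2 := h t
    rw [mul_comm, pow_mul, pow_mul, ← one_pow (M := k) (p ^ e), ← add_pow_expChar_pow] at h2
    simp only [one_pow] at h2
    exact iterateFrobenius_inj k p e h2
  have h2 : (1 + Polynomial.X : Polynomial k) ^ r = 1 + Polynomial.X ^ r :=
    Polynomial.funext fun t => by simp [h1]
  refine ⟨e, ?_⟩
  rcases eq_or_ne r 1 with rfl | hr1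
  · simp
  · exfalso
    have h3 := congrArg (fun Q => Polynomial.coeff Q 1) h2
    simp only [Polynomial.coeff_one_add_X_pow, Nat.choose_one_right, Polynomial.coeff_add,
      Polynomial.coeff_X_pow, Polynomial.coeff_one, if_neg hr1.symm] at h3
    apply hr
    rw [← CharP.cast_eq_zero_iff k p, h3]
    simp

end Unipotent

/-! ### The Weyl element and the Bruhat decomposition. -/

section Weyl

variable {k : Type*} [Field k]

/-- The Weyl element `(0, 1; -1, 0)` of `SL(2, k)`. -/
def weyl (k : Type*) [Field k] : SpecialLinearGroup (Fin 2) k :=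
  ⟨!![0, 1; -1, 0], by simp [Matrix.det_fin_two]⟩

theorem iota_unip (t : k) : (iota k (unip k t)).1 = !![1, t; 0, 1] := by
  change iotaMatrix k _ = _
  simp [iotaMatrix, unip]

theorem iota_inr (z : kˣ) :
    (iota k (SemidirectProduct.inr z)).1 = !![(z : k), 0; 0, ((z⁻¹ : kˣ) : k)] := by
  change iotaMatrix k _ = _
  simp [iotaMatrix]

theorem weyl_mul_iota_inr (z : kˣ) :
    weyl k * iota k (SemidirectProduct.inr z) = iota k (SemidirectProduct.inr z⁻¹) * weyl k := by
  refine Subtype.ext ?_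
  rw [Matrix.SpecialLinearGroup.coe_mul, Matrix.SpecialLinearGroup.coe_mul, iota_inr, iota_inr]
  simp [weyl]

theorem weyl_braid :
    weyl k * iota k (unip k (-1)) * weyl k = iota k (unip k 1) * weyl k * iota k (unip k 1) := by
  refine Subtype.ext ?_
  simp only [Matrix.SpecialLinearGroup.coe_mul, iota_unip]
  simp [weyl]

/-- The Bruhat decomposition: `SL(2, k)` is generated by the upper triangular matrices and the
Weyl element. -/
theorem exists_bruhat (g : SpecialLinearGroup (Fin 2) k) :
    (∃ b, g = iota k b) ∨ ∃ b₁ b₂, g = iota k b₁ * weyl k * iota k b₂ := by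
  have hdet : g.1 0 0 * g.1 1 1 - g.1 0 1 * g.1 1 0 = 1 := by
    rw [← Matrix.det_fin_two]
    exact g.2
  by_cases hc : g.1 1 0 = 0
  · left
    rw [hc, mul_zero, sub_zero] at hdet
    have ha : g.1 0 0 ≠ 0 := left_ne_zero_of_mul_eq_one hdet
    refine ⟨unip k (g.1 0 1 * g.1 0 0) * SemidirectProduct.inr (Units.mk0 _ ha), Subtype.ext ?_⟩
    rw [map_mul, Matrix.SpecialLinearGroup.coe_mul, iota_unip, iota_inr]
    ext i j
    fin_cases i <;> fin_cases j <;> simp [hc, ha]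
    exact eq_inv_of_mul_eq_one_right hdet
  · right
    -- The Weyl element times `diag(-c, -1/c)` is `(0, -1/c; c, 0)`. The two unipotent factors
    -- restore `a` and `d`, and the determinant then gives `b`.
    refine ⟨unip k (g.1 0 0 / g.1 1 0),
      SemidirectProduct.inr (Units.mk0 _ (neg_ne_zero.2 hc)) * unip k (g.1 1 1 / g.1 1 0),
      Subtype.ext ?_⟩
    rw [map_mul, Matrix.SpecialLinearGroup.coe_mul, Matrix.SpecialLinearGroup.coe_mul,
      Matrix.SpecialLinearGroup.coe_mul, iota_unip, iota_unip, iota_inr]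
    ext i j
    fin_cases i <;> fin_cases j <;> simp [weyl] <;> field_simp
    linear_combination -hdet

theorem monoidHom_eq_of_iota_of_weyl {H : Type*} [Group H]
    {ψ₁ ψ₂ : SpecialLinearGroup (Fin 2) k →* H}
    (h : ψ₁.comp (iota k) = ψ₂.comp (iota k)) (hw : ψ₁ (weyl k) = ψ₂ (weyl k)) : ψ₁ = ψ₂ := by
  have hb : ∀ b, ψ₁ (iota k b) = ψ₂ (iota k b) := fun b => DFunLike.congr_fun h b
  ext1 g
  rcases exists_bruhat g with ⟨b, rfl⟩ | ⟨b₁, b₂, rfl⟩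
  · exact hb b
  · simp only [map_mul, hb, hw]

variable {n : ℕ} {φ : GaGm k →* SpecialLinearGroup (Fin n) k}
  {ψ : SpecialLinearGroup (Fin 2) k →* SpecialLinearGroup (Fin n) k}

theorem exists_row_ne_zero (A : SpecialLinearGroup (Fin n) k) (i : Fin n) : ∃ j, A.1 i j ≠ 0 := by
  by_contra! h
  exact one_ne_zero (A.2.symm.trans (Matrix.det_eq_zero_of_row_eq_zero i h))

theorem weyl_braid_map (hψ : ψ.comp (iota k) = φ) :
    (ψ (weyl k)).1 * (φ (unip k (-1))).1 * (ψ (weyl k)).1 =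
      (φ (unip k 1)).1 * (ψ (weyl k)).1 * (φ (unip k 1)).1 := by
  have h := congrArg (fun g => (ψ g).1) (weyl_braid (k := k))
  have h2 : ∀ g, ψ (iota k g) = φ g := fun g => DFunLike.congr_fun hψ g
  simpa only [map_mul, h2, Matrix.SpecialLinearGroup.coe_mul] using h

/-- With trivial `φ` the braid relation reads `W² = W`, so `W = 1`. -/
theorem extension_unique_one
    (hψ : ψ.comp (iota k) = 1) : ψ = 1 := by
  refine monoidHom_eq_of_iota_of_weyl (by rw [hψ]; rfl) ?_
  have h := congrArg ψ (weyl_braid (k := k))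
  have h2 : ∀ g, ψ (iota k g) = 1 := fun g => DFunLike.congr_fun hψ g
  simp only [map_mul, h2, mul_one, one_mul] at h
  simpa using h

end Weyl

/-! ### Constraints from the weights. -/

section Structure

variable {k : Type*} [Field k] [IsAlgClosed k] {n : ℕ}

theorem HasWeights.unique {h : kˣ →* SpecialLinearGroup (Fin n) k} {ℓ m : Fin n → ℤ}
    (hℓ : HasWeights h ℓ) (hm : HasWeights h m) : ℓ = m := by
  funext i
  refine zpow_injective_of_forall (k := k) fun z => ?_
  have h1 := (hℓ z).symm.trans (hm z)
  simpa using congrFun (congrFun h1 i) i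

theorem HasWeights.weight_eq_of_intertwine {h₁ h₂ : kˣ →* SpecialLinearGroup (Fin n) k}
    {ℓ m : Fin n → ℤ} (hℓ : HasWeights h₁ ℓ) (hm : HasWeights h₂ m)
    {P : Matrix (Fin n) (Fin n) k} (hP : ∀ z, (h₁ z).1 * P = P * (h₂ z).1) {i j : Fin n}
    (hij : P i j ≠ 0) : ℓ i = m j := by
  refine zpow_injective_of_forall (k := k) fun z => ?_
  have h1 := congrFun (congrFun (hP z) i) j
  rw [hℓ, hm, Matrix.diagonal_mul, Matrix.mul_diagonal, mul_comm] at h1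
  exact mul_left_cancel₀ hij h1

theorem HasWeights.sum_eq_zero {h : kˣ →* SpecialLinearGroup (Fin 3) k} {ℓ : Fin 3 → ℤ}
    (hℓ : HasWeights h ℓ) : ℓ 0 + ℓ 1 + ℓ 2 = 0 := by
  refine zpow_injective_of_forall (k := k) fun z => ?_
  have h1 := (h z).2
  rw [hℓ, Matrix.det_diagonal, Fin.prod_univ_three] at h1
  rw [zpow_add₀ z.ne_zero, zpow_add₀ z.ne_zero, h1, zpow_zero]

variable {φ : GaGm k →* SpecialLinearGroup (Fin n) k}
  {ψ : SpecialLinearGroup (Fin 2) k →* SpecialLinearGroup (Fin n) k}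

/-- The Weyl element conjugates the torus by inversion; compare the entries `(i, j)`. -/
theorem weight_eq_neg_of_weyl_ne_zero (hψ : ψ.comp (iota k) = φ) {ℓ : Fin n → ℤ}
    (hℓ : HasWeights (torusPart φ) ℓ) {i j : Fin n} (hij : (ψ (weyl k)).1 i j ≠ 0) :
    ℓ j = -ℓ i := by
  refine zpow_injective_of_forall (k := k) fun z => ?_
  have h1 := congrArg ψ (weyl_mul_iota_inr z)
  have h2 : ∀ z, ψ (iota k (SemidirectProduct.inr z)) = torusPart φ z := fun z =>
    DFunLike.congr_fun hψ _
  rw [map_mul, map_mul, h2, h2] at h1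
  have h3 := congrFun (congrFun (congrArg Subtype.val h1) i) j
  rw [Matrix.SpecialLinearGroup.coe_mul, Matrix.SpecialLinearGroup.coe_mul, hℓ, hℓ,
    Matrix.mul_diagonal, Matrix.diagonal_mul, mul_comm] at h3
  rw [mul_right_cancel₀ hij h3]
  simp

/-- Conjugation by the torus sends `unip 1` to `unip z²` and multiplies the entry by `z ^ (ℓ i - ℓ
j)`. The entry is thus a homogeneous polynomial in `t`. -/
theorem unip_entry (hφ : IsRep (coordGaGm k) φ) {ℓ : Fin n → ℤ}
    (hℓ : HasWeights (torusPart φ) ℓ) (i j : Fin n) :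
    (∀ t, (φ (unip k t)).1 i j = 0) ∨ ∃ m : ℕ, ℓ i - ℓ j = 2 * m ∧
      ∀ t, (φ (unip k t)).1 i j = (φ (unip k 1)).1 i j * t ^ m := by
  obtain ⟨F, hF⟩ := exists_polynomial_unip (hφ i j)
  have hhom : ∀ (z : kˣ), F.eval ((z : k) ^ 2) = (z : k) ^ (ℓ i - ℓ j) * F.eval 1 := by
    intro z
    have h1 := congrArg (fun g => (φ g).1) (inr_mul_unip z 1)
    simp only [map_mul, Matrix.SpecialLinearGroup.coe_mul, mul_one] at h1
    have h2 := congrFun (congrFun h1 i) j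
    change ((torusPart φ z).1 * (φ (unip k 1)).1) i j =
      ((φ (unip k ((z : k) ^ 2))).1 * (torusPart φ z).1) i j at h2
    rw [hℓ, Matrix.diagonal_mul, Matrix.mul_diagonal, hF, hF] at h2
    rw [zpow_sub₀ z.ne_zero, div_mul_eq_mul_div, h2, mul_div_assoc,
      div_self (zpow_ne_zero _ z.ne_zero), mul_one]
  by_cases h0 : F.eval 1 = 0
  · left
    have hF0 : F = 0 := by
      have h1 : Polynomial.expand k 2 F = 0 := by
        refine polynomial_eq_of_forall_units fun z => ?_
        rw [Polynomial.expand_eval, hhom, h0, mul_zero, Polynomial.eval_zero]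
      exact (Polynomial.expand_eq_zero two_pos).1 h1
    intro t
    rw [hF, hF0, Polynomial.eval_zero]
  · right
    obtain ⟨m, hm, h⟩ := eval_eq_monomial_of_homogeneous hhom h0
    exact ⟨m, hm, fun t => by rw [hF, hF, h]⟩

theorem unip_entry_of_le (hφ : IsRep (coordGaGm k) φ) {ℓ : Fin n → ℤ}
    (hℓ : HasWeights (torusPart φ) ℓ) {i j : Fin n} (hij : ℓ i ≤ ℓ j) (t : k) :
    (φ (unip k t)).1 i j = (1 : Matrix (Fin n) (Fin n) k) i j := by
  have h0 : (φ (unip k 0)).1 i j = (1 : Matrix (Fin n) (Fin n) k) i j := by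
    rw [unip_zero, map_one, Matrix.SpecialLinearGroup.coe_one]
  rcases unip_entry hφ hℓ i j with h | ⟨m, hm, h⟩
  · rw [h, ← h0, h]
  · obtain rfl : m = 0 := by omega
    rw [h, ← h0, h 0]
    simp

theorem eq_one_of_weights_zero (hφ : IsRep (coordGaGm k) φ)
    (hℓ : HasWeights (torusPart φ) 0) : φ = 1 := by
  ext1 g
  refine Subtype.ext ?_
  have h1 : (φ (SemidirectProduct.inr g.right)).1 = 1 := by
    change (torusPart φ g.right).1 = 1
    rw [hℓ]
    simp
  have h2 : (φ (unip k g.left.toAdd)).1 = 1 := by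
    ext i j
    exact unip_entry_of_le hφ hℓ (by simp) _
  rw [eq_unip_mul_inr g, map_mul, Matrix.SpecialLinearGroup.coe_mul, h1, h2]
  simp

end Structure

/-! ### Dimension three: weights and the image of the Weyl element. -/

section Dimension3

variable {k : Type*} [Field k] [IsAlgClosed k]
  {φ : GaGm k →* SpecialLinearGroup (Fin 3) k}
  {ψ : SpecialLinearGroup (Fin 2) k →* SpecialLinearGroup (Fin 3) k}

/-- Rows 0 and 2 of `W` are nonzero, so `-ℓ 0` and `-ℓ 2` are weights. The ordering then forces `ℓ 2
= -ℓ 0`, and the zero sum gives `ℓ 1 = 0`. -/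
theorem exists_weights_eq (hψ : ψ.comp (iota k) = φ) {ℓ : Fin 3 → ℤ}
    (hℓ : HasWeights (torusPart φ) ℓ) (hanti : Antitone ℓ) :
    ∃ m : ℕ, ℓ = ![(m : ℤ), 0, -m] := by
  have hs := hℓ.sum_eq_zero
  obtain ⟨i, hi⟩ := exists_row_ne_zero (ψ (weyl k)) 0
  obtain ⟨j, hj⟩ := exists_row_ne_zero (ψ (weyl k)) 2
  have h1 := weight_eq_neg_of_weyl_ne_zero hψ hℓ hi
  have h2 := weight_eq_neg_of_weyl_ne_zero hψ hℓ hj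
  have h3 : ℓ 2 ≤ ℓ i := hanti (Fin.le_last i)
  have h4 : ℓ j ≤ ℓ 0 := hanti (Fin.zero_le j)
  have h5 : ℓ 2 ≤ ℓ 0 := hanti (Fin.zero_le 2)
  refine ⟨(ℓ 0).toNat, ?_⟩
  funext l
  fin_cases l <;> simp <;> omega

theorem weyl_eq_zero {m : ℕ} (hm : m ≠ 0) (hψ : ψ.comp (iota k) = φ)
    (hℓ : HasWeights (torusPart φ) ![(m : ℤ), 0, -m]) {i j : Fin 3} (hij : i.1 + j.1 ≠ 2) :
    (ψ (weyl k)).1 i j = 0 := by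
  by_contra h
  have h1 := weight_eq_neg_of_weyl_ne_zero hψ hℓ h
  fin_cases i <;> fin_cases j <;> simp at hij h1 <;> omega

/-- The upper unitriangular matrix with given entries. -/
def unitri (α β γ : k) : Matrix (Fin 3) (Fin 3) k :=
  !![1, α, γ; 0, 1, β; 0, 0, 1]

/-- The three weights are distinct, so `W` is antidiagonal. The `(0,0)` and `(2,0)` entries of the
braid relation and `det W = 1` give the equations, which determine `W` from `φ`. -/
theorem weyl_entries {m : ℕ} (hm : m ≠ 0) (hψ : ψ.comp (iota k) = φ)
    (hℓ : HasWeights (torusPart φ) ![(m : ℤ), 0, -m]) {α β γ : k}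
    (hU : (φ (unip k 1)).1 = unitri α β γ) :
    ∃ y z, (ψ (weyl k)).1 = !![0, 0, γ; 0, y, 0; z, 0, 0] ∧ γ * y * z = -1 ∧
      z * (α * β - γ) = 1 := by
  have hU' : (φ (unip k (-1))).1 = unitri (-α) (-β) (α * β - γ) := by
    have h1 : (φ (unip k 1)).1 * (φ (unip k (-1))).1 = 1 := by
      rw [← Matrix.SpecialLinearGroup.coe_mul, ← map_mul, ← unip_add, add_neg_cancel, unip_zero,
        map_one, Matrix.SpecialLinearGroup.coe_one]
    have h2 : unitri (-α) (-β) (α * β - γ) * (φ (unip k 1)).1 = 1 := by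
      rw [hU, unitri, unitri, Matrix.mul_fin_three, Matrix.one_fin_three]
      congr <;> ring_nf
    rw [← Matrix.one_mul (φ (unip k (-1))).1, ← h2, Matrix.mul_assoc, h1, Matrix.mul_one]
  set W := (ψ (weyl k)).1 with hWdef
  have hW : W = !![0, 0, W 0 2; 0, W 1 1, 0; W 2 0, 0, 0] := by
    ext i j
    fin_cases i <;> fin_cases j <;> first | rfl | exact weyl_eq_zero hm hψ hℓ (by decide)
  have hbr := weyl_braid_map hψ
  have hdet : W.det = 1 := (ψ (weyl k)).2
  rw [← hWdef, hU, hU'] at hbr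
  generalize W 0 2 = x at hW
  generalize W 1 1 = y at hW
  generalize W 2 0 = z at hW
  rw [hW] at hbr hdet
  rw [Matrix.det_fin_three] at hdet
  have hdet' : x * y * z = -1 := by
    simp at hdet
    linear_combination -hdet
  have hz : z ≠ 0 := by
    rintro rfl
    simp at hdet'
  rw [unitri, unitri, Matrix.mul_fin_three, Matrix.mul_fin_three, Matrix.mul_fin_three,
    Matrix.mul_fin_three] at hbr
  have e1 := congrFun (congrFun hbr 0) 0
  have e2 := congrFun (congrFun hbr 2) 0
  simp at e1 e2
  have hx : x = γ := by
    rcases e1 with h | h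
    · exact h
    · exact absurd h hz
  subst hx
  refine ⟨y, z, hW, hdet', mul_left_cancel₀ hz ?_⟩
  linear_combination e2

theorem extension_unique {m : ℕ} (hm : m ≠ 0)
    {ψ' : SpecialLinearGroup (Fin 2) k →* SpecialLinearGroup (Fin 3) k}
    (hψ : ψ.comp (iota k) = φ) (hψ' : ψ'.comp (iota k) = φ)
    (hℓ : HasWeights (torusPart φ) ![(m : ℤ), 0, -m]) {α β γ : k}
    (hU : (φ (unip k 1)).1 = unitri α β γ) : ψ = ψ' := by
  refine monoidHom_eq_of_iota_of_weyl (hψ.trans hψ'.symm) (Subtype.ext ?_)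
  obtain ⟨y, z, h1, h2, h3⟩ := weyl_entries hm hψ hℓ hU
  obtain ⟨y', z', h1', h2', h3'⟩ := weyl_entries hm hψ' hℓ hU
  have hz : z = z' := mul_right_cancel₀ (right_ne_zero_of_mul_eq_one h3) (h3.trans h3'.symm)
  subst hz
  have hγ : γ * z ≠ 0 := by
    intro h
    have : (0 : k) = -1 := by rw [← h2, mul_right_comm, h, zero_mul]
    simp at this
  have hy : y = y' := mul_left_cancel₀ hγ (by linear_combination h2 - h2')
  rw [h1, h1', hy]

end Dimension3

/-! ### The explicit forms and their extensions. -/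

section Forms

variable {k : Type*} [Field k]

/-- The value at `(a, b; c, d)` of the extension to `SL(2, k)` of the form with exponent `0`. -/
def SharpForm.extMatrix (a b c d : k) : SharpForm → Matrix (Fin 3) (Fin 3) k
  | .I => !![a ^ 2, a * b, 1 / 2 * b ^ 2; 2 * (a * c), a * d + b * c, b * d;
             2 * c ^ 2, 2 * (c * d), d ^ 2]
  | .IV => !![a, 0, b; 0, 1, 0; c, 0, d]
  | .V => !![a ^ 2, a * b, b ^ 2; 0, 1, 0; c ^ 2, c * d, d ^ 2]
  | .VII => !![a ^ 2, 0, b ^ 2; a * c, 1, b * d; c ^ 2, 0, d ^ 2]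
  | .XII => 1

theorem two_ne_zero_of_three_le {p : ℕ} [CharP k p] (hp : 3 ≤ p) : (2 : k) ≠ 0 := by
  intro h
  have h1 : p ∣ 2 := (CharP.cast_eq_zero_iff k p 2).1 (by exact_mod_cast h)
  exact absurd (Nat.le_of_dvd two_pos h1) (by omega)

theorem SharpForm.extMatrix_det {p : ℕ} [CharP k p] (lam : SharpForm) (hlam : lam.Admissible p)
    {a b c d : k} (h : a * d - b * c = 1) : (lam.extMatrix a b c d).det = 1 := by
  cases lam with
  | I =>
    have h2 : (2 : k) ≠ 0 := two_ne_zero_of_three_le hlam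
    have h3 : (a * d - b * c) ^ 3 = 1 := by rw [h, one_pow]
    rw [extMatrix, Matrix.det_fin_three]
    simp
    field_simp
    linear_combination h3
  | IV =>
    rw [extMatrix, Matrix.det_fin_three]
    simp
    linear_combination h
  | V =>
    obtain rfl : p = 2 := hlam
    have h2 : (2 : k) = 0 := CharTwo.two_eq_zero
    rw [extMatrix, Matrix.det_fin_three]
    simp
    linear_combination (a * d - b * c + 1) * h + (a * d * b * c - b ^ 2 * c ^ 2) * h2
  | VII =>
    obtain rfl : p = 2 := hlam
    have h2 : (2 : k) = 0 := CharTwo.two_eq_zero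
    rw [extMatrix, Matrix.det_fin_three]
    simp
    linear_combination (a * d - b * c + 1) * h + (a * d * b * c - b ^ 2 * c ^ 2) * h2
  | XII => exact Matrix.det_one

/-- I is the symmetric square in a rescaled basis, and IV is the standard representation plus a
trivial one. V is the symmetric square in characteristic 2, where `ad + bc = 1` gives the central 1.
VII is `g ↦ V(gᵀ)ᵀ`. -/
theorem SharpForm.extMatrix_mul {p : ℕ} [CharP k p] (lam : SharpForm) (hlam : lam.Admissible p)
    {a b c d a' b' c' d' : k} (h : a * d - b * c = 1) (h' : a' * d' - b' * c' = 1) :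
    lam.extMatrix (a * a' + b * c') (a * b' + b * d') (c * a' + d * c') (c * b' + d * d') =
      lam.extMatrix a b c d * lam.extMatrix a' b' c' d' := by
  cases lam with
  | I =>
    have h2 : (2 : k) ≠ 0 := two_ne_zero_of_three_le hlam
    rw [extMatrix, extMatrix, extMatrix, Matrix.mul_fin_three]
    ext i j
    fin_cases i <;> fin_cases j <;> simp <;> field_simp <;> ring
  | IV =>
    rw [extMatrix, extMatrix, extMatrix, Matrix.mul_fin_three]
    ext i j
    fin_cases i <;> fin_cases j <;> simp
  | V =>
    obtain rfl : p = 2 := hlam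
    have h2 : (2 : k) = 0 := CharTwo.two_eq_zero
    rw [extMatrix, extMatrix, extMatrix, Matrix.mul_fin_three]
    ext i j
    fin_cases i <;> fin_cases j <;> simp
    · linear_combination (a * a' * b * c') * h2
    · linear_combination a * b * h' + a * b * b' * c' * h2
    · linear_combination (a * b' * b * d') * h2
    · linear_combination (c * a' * d * c') * h2
    · linear_combination c * d * h' + c * d * b' * c' * h2
    · linear_combination (c * b' * d * d') * h2
  | VII =>
    obtain rfl : p = 2 := hlam
    have h2 : (2 : k) = 0 := CharTwo.two_eq_zero
    rw [extMatrix, extMatrix, extMatrix, Matrix.mul_fin_three]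
    ext i j
    fin_cases i <;> fin_cases j <;> simp
    · linear_combination (a * a' * b * c') * h2
    · linear_combination (a * b' * b * d') * h2
    · linear_combination a' * c' * h + a' * c' * b * c * h2
    · linear_combination b' * d' * h + b' * d' * b * c * h2
    · linear_combination (c * a' * d * c') * h2
    · linear_combination (c * b' * d * d') * h2
  | XII => exact (Matrix.one_mul 1).symm

theorem SharpForm.extMatrix_isRegular {G ι : Type*} {x : G → ι → k} (lam : SharpForm)
    {a b c d : G → k} (ha : IsRegular x a) (hb : IsRegular x b) (hc : IsRegular x c)
    (hd : IsRegular x d) (i j : Fin 3) :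
    IsRegular x (fun g => lam.extMatrix (a g) (b g) (c g) (d g) i j) := by
  cases lam
  case XII => exact IsRegular.const _
  case I =>
    fin_cases i <;> fin_cases j
    · exact ha.pow 2
    · exact ha.mul hb
    · exact (IsRegular.const _).mul (hb.pow 2)
    · exact (IsRegular.const _).mul (ha.mul hc)
    · exact (ha.mul hd).add (hb.mul hc)
    · exact hb.mul hd
    · exact (IsRegular.const _).mul (hc.pow 2)
    · exact (IsRegular.const _).mul (hc.mul hd)
    · exact hd.pow 2
  all_goals
    fin_cases i <;> fin_cases j <;> first
      | exact IsRegular.const _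
      | exact ha
      | exact hb
      | exact hc
      | exact hd
      | exact ha.pow 2
      | exact hb.pow 2
      | exact hc.pow 2
      | exact hd.pow 2
      | exact ha.mul hb
      | exact ha.mul hc
      | exact hb.mul hd
      | exact hc.mul hd

/-- The extension to `SL(2, k)` of the form with exponent `0`. -/
def SharpForm.ext {p : ℕ} [CharP k p] (lam : SharpForm) (hlam : lam.Admissible p) :
    SpecialLinearGroup (Fin 2) k →* SpecialLinearGroup (Fin 3) k where
  toFun g := ⟨lam.extMatrix (g.1 0 0) (g.1 0 1) (g.1 1 0) (g.1 1 1),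
    lam.extMatrix_det hlam ((Matrix.det_fin_two g.1).symm.trans g.2)⟩
  map_one' := Subtype.ext (by
    cases lam <;> ext i j <;> fin_cases i <;> fin_cases j <;> simp [extMatrix])
  map_mul' g h := Subtype.ext (by
    have hgh : ∀ i j, (g * h).1 i j = g.1 i 0 * h.1 0 j + g.1 i 1 * h.1 1 j := fun i j => by
      rw [Matrix.SpecialLinearGroup.coe_mul, Matrix.mul_apply, Fin.sum_univ_two]
    change lam.extMatrix ((g * h).1 0 0) ((g * h).1 0 1) ((g * h).1 1 0) ((g * h).1 1 1) = _
    rw [hgh, hgh, hgh, hgh]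
    exact lam.extMatrix_mul hlam ((Matrix.det_fin_two g.1).symm.trans g.2)
        ((Matrix.det_fin_two h.1).symm.trans h.2))

/-- The extension to `SL(2, k)` of the form with exponent `e`. -/
def SharpForm.twist {p : ℕ} [ExpChar k p] [CharP k p] (e : ℕ) (lam : SharpForm)
    (hlam : lam.Admissible p) : SpecialLinearGroup (Fin 2) k →* SpecialLinearGroup (Fin 3) k :=
  (lam.ext hlam).comp (Matrix.SpecialLinearGroup.map (iterateFrobenius k p e))

theorem SharpForm.twist_apply {p : ℕ} [ExpChar k p] [CharP k p] (e : ℕ) (lam : SharpForm)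
    (hlam : lam.Admissible p) (g : SpecialLinearGroup (Fin 2) k) :
    (lam.twist e hlam g).1 = lam.extMatrix (g.1 0 0 ^ p ^ e) (g.1 0 1 ^ p ^ e) (g.1 1 0 ^ p ^ e)
      (g.1 1 1 ^ p ^ e) := rfl

theorem SharpForm.twist_isRep {p : ℕ} [ExpChar k p] [CharP k p] (e : ℕ) (lam : SharpForm)
    (hlam : lam.Admissible p) : IsRep (coordSL2 k) (lam.twist e hlam) := by
  have h : ∀ ij : Fin 2 × Fin 2,
      IsRegular (coordSL2 k) (fun g => coordSL2 k g ij ^ p ^ e) := fun ij =>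
    (IsRegular.coord ij).pow _
  exact lam.extMatrix_isRegular (h (0, 0)) (h (0, 1)) (h (1, 0)) (h (1, 1))

theorem SharpForm.twist_isGivenBy {p : ℕ} (hp : p.Prime) [ExpChar k p] [CharP k p] (e : ℕ)
    (lam : SharpForm) (hlam : lam.Admissible p) :
    IsGivenBy p e lam ((lam.twist e hlam).comp (iota k)) := by
  intro g
  change (lam.twist e hlam (iota k g)).1 = _
  have h10 : (iota k g).1 1 0 = 0 := rfl
  have hq : p ^ e ≠ 0 := pow_ne_zero _ hp.ne_zero
  have had : (iota k g).1 0 0 ^ p ^ e * (iota k g).1 1 1 ^ p ^ e = 1 := by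
    have h := (iota k g).2
    rw [Matrix.det_fin_two, h10, mul_zero, sub_zero] at h
    rw [← mul_pow, h, one_pow]
  rw [twist_apply, h10, zero_pow hq]
  generalize (iota k g).1 0 0 = a at had
  generalize (iota k g).1 1 1 = d at had
  cases lam <;> ext i j <;> fin_cases i <;> fin_cases j <;>
    simp [extMatrix, SharpForm.matrix, had, ← pow_mul, mul_comm 2]

/-- The weight of a form with exponent `e`: the torus acts by `diag(z ^ m, 1, z ^ (-m))`. -/
def SharpForm.weight (p e : ℕ) : SharpForm → ℕ
  | .I => 2 * p ^ e
  | .IV => p ^ e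
  | .V => 2 * p ^ e
  | .VII => 2 * p ^ e
  | .XII => 0

/-- This matches `(t, z) = (t, 1)(0, z)`, so weights and unipotent part can be read off separately.
-/
theorem SharpForm.matrix_factor {p : ℕ} (lam : SharpForm) (e : ℕ) (z : kˣ) (t : k) :
    lam.matrix p e (z : k) (t * ((z⁻¹ : kˣ) : k)) ((z⁻¹ : kˣ) : k) =
      lam.matrix p e 1 t 1 * Matrix.diagonal
        (fun i => (z : k) ^ (![(lam.weight p e : ℤ), 0, -(lam.weight p e : ℤ)] i)) := by
  have hz : (z : k) ≠ 0 := z.ne_zero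
  ext i j
  rw [Matrix.mul_diagonal]
  generalize hq : p ^ e = q
  cases lam <;> fin_cases i <;> fin_cases j <;>
    simp [SharpForm.matrix, SharpForm.weight, hq, mul_pow, zpow_mul] <;> field_simp
  all_goals
    try simp only [← pow_mul]
  all_goals first | exact Or.inl trivial | rw [mul_comm 2 q]

theorem IsGivenBy.apply {p e : ℕ} {lam : SharpForm}
    {φ : GaGm k →* SpecialLinearGroup (Fin 3) k} (h : IsGivenBy p e lam φ) (t : k) (z : kˣ) :
    (φ (unip k t * SemidirectProduct.inr z)).1 = lam.matrix p e 1 t 1 * Matrix.diagonal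
        (fun i => (z : k) ^ (![(lam.weight p e : ℤ), 0, -(lam.weight p e : ℤ)] i)) := by
  have h1 : (iota k (unip k t * SemidirectProduct.inr z)).1 =
      !![(z : k), t * ((z⁻¹ : kˣ) : k); 0, ((z⁻¹ : kˣ) : k)] := by
    rw [map_mul, Matrix.SpecialLinearGroup.coe_mul, iota_unip, iota_inr]
    simp
  rw [h, ← SharpForm.matrix_factor, h1]
  rfl

end Forms

/-! ### Existence of the forms and uniqueness of extensions. -/

section Existence

variable {k : Type*} [Field k]

theorem SharpForm.matrix_eq_unitri {p e : ℕ} (lam : SharpForm) :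
    ∃ α β γ : k, lam.matrix p e 1 1 1 = unitri α β γ := by
  cases lam
  case XII => exact ⟨0, 0, 0, rfl⟩
  all_goals exact ⟨_, _, _, by simp only [SharpForm.matrix, one_pow]; rfl⟩

theorem IsGivenBy.apply_unip {p e : ℕ} {lam : SharpForm}
    {φ : GaGm k →* SpecialLinearGroup (Fin 3) k} (h : IsGivenBy p e lam φ) (t : k) :
    (φ (unip k t)).1 = lam.matrix p e 1 t 1 := by
  have h1 := h.apply t 1
  rw [map_one, mul_one] at h1
  simpa using h1

theorem IsGivenBy.hasWeights {p e : ℕ} {lam : SharpForm}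
    {φ : GaGm k →* SpecialLinearGroup (Fin 3) k} (h : IsGivenBy p e lam φ) :
    HasWeights (torusPart φ) ![(lam.weight p e : ℤ), 0, -(lam.weight p e : ℤ)] := by
  intro z
  have h1 := h.apply 0 z
  rwa [← h.apply_unip, unip_zero, one_mul, map_one, Matrix.SpecialLinearGroup.coe_one,
    Matrix.one_mul] at h1

theorem IsGivenBy.unique {p e : ℕ} {lam : SharpForm}
    {φ φ' : GaGm k →* SpecialLinearGroup (Fin 3) k} (h : IsGivenBy p e lam φ)
    (h' : IsGivenBy p e lam φ') : φ = φ' := by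
  ext1 g
  exact Subtype.ext ((h g).trans (h' g).symm)

variable [IsAlgClosed k]

theorem IsGivenBy.extension_unique {p e : ℕ} (hp : p.Prime) {lam : SharpForm}
    {φ : GaGm k →* SpecialLinearGroup (Fin 3) k} (h : IsGivenBy p e lam φ)
    {ψ ψ' : SpecialLinearGroup (Fin 2) k →* SpecialLinearGroup (Fin 3) k}
    (hψ : ψ.comp (iota k) = φ) (hψ' : ψ'.comp (iota k) = φ) : ψ = ψ' := by
  by_cases hm : lam.weight p e = 0
  · have hφ : φ = 1 := by
      cases lam <;> simp [SharpForm.weight, hp.ne_zero] at hm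
      ext1 g
      refine Subtype.ext ((h g).trans ?_)
      exact Matrix.one_fin_three.symm
    rw [extension_unique_one (hψ.trans hφ), extension_unique_one (hψ'.trans hφ)]
  · obtain ⟨α, β, γ, hU⟩ := lam.matrix_eq_unitri (k := k) (p := p) (e := e)
    exact AlgRep.extension_unique hm hψ hψ' h.hasWeights ((h.apply_unip 1).trans hU)

theorem exists_isGivenBy {p : ℕ} (hp : p.Prime) [CharP k p] (lam : SharpForm)
    (hlam : lam.Admissible p) (e : ℕ) :
    ∃ φ : GaGm k →* SpecialLinearGroup (Fin 3) k,
      IsGivenBy p e lam φ ∧ IsRep (coordGaGm k) φ ∧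
        ∃! ψ : SpecialLinearGroup (Fin 2) k →* SpecialLinearGroup (Fin 3) k, IsExtension φ ψ := by
  have : ExpChar k p := ExpChar.prime hp
  have h := lam.twist_isGivenBy (k := k) hp e hlam
  refine ⟨_, h, (lam.twist_isRep e hlam).comp_iota, lam.twist e hlam,
    ⟨lam.twist_isRep e hlam, rfl⟩, fun ψ hψ => ?_⟩
  exact h.extension_unique hp hψ.2 rfl

end Existence

/-! ### Classification up to equivalence. -/

section Classification

variable {k : Type*} [Field k] [IsAlgClosed k]
  {φ : GaGm k →* SpecialLinearGroup (Fin 3) k}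
  {ψ : SpecialLinearGroup (Fin 2) k →* SpecialLinearGroup (Fin 3) k}

/-- A representation with weights `(m, 0, -m)`, `m ≠ 0`, that extends to `SL(2, k)` becomes one of
the forms on the unipotent part after conjugation by a diagonal matrix. -/
theorem exists_form_unip {p : ℕ} (hp : p.Prime) [CharP k p] (hφ : IsRep (coordGaGm k) φ)
    (hψ : ψ.comp (iota k) = φ) {m : ℕ} (hm : m ≠ 0)
    (hℓ : HasWeights (torusPart φ) ![(m : ℤ), 0, -m]) :
    ∃ lam : SharpForm, lam.Admissible p ∧ ∃ e, lam.weight p e = m ∧ ∃ D : Fin 3 → k,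
      (∀ i, D i ≠ 0) ∧ ∀ t, (φ (unip k t)).1 * Matrix.diagonal D =
        Matrix.diagonal D * lam.matrix p e 1 t 1 := by
  set u : k → Matrix (Fin 3) (Fin 3) k := fun t => (φ (unip k t)).1 with hu
  have hle : ∀ t i j, (![(m : ℤ), 0, -m] : Fin 3 → ℤ) i ≤ (![(m : ℤ), 0, -m] : Fin 3 → ℤ) j →
      u t i j = (1 : Matrix (Fin 3) (Fin 3) k) i j :=
    fun t i j hij => unip_entry_of_le hφ hℓ hij t
  have hshape : ∀ t, u t = unitri (u t 0 1) (u t 1 2) (u t 0 2) := by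
    intro t
    ext i j
    fin_cases i <;> fin_cases j <;> first
      | rfl
      | exact hle t _ _ (by simp)
  have hadd : ∀ s t, u (s + t) = u s * u t := fun s t => by
    simp only [hu, unip_add, map_mul, Matrix.SpecialLinearGroup.coe_mul]
  have hadd' : ∀ s t, u (s + t) = unitri (u s 0 1) (u s 1 2) (u s 0 2) *
      unitri (u t 0 1) (u t 1 2) (u t 0 2) := fun s t => by
    rw [← hshape, ← hshape, hadd]
  have hadd01 : ∀ s t, u (s + t) 0 1 = u t 0 1 + u s 0 1 := fun s t => by
    rw [hadd']
    simp [unitri, Matrix.mul_apply, Fin.sum_univ_three]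
  have hadd12 : ∀ s t, u (s + t) 1 2 = u t 1 2 + u s 1 2 := fun s t => by
    rw [hadd']
    simp [unitri, Matrix.mul_apply, Fin.sum_univ_three]
  have hadd02 : ∀ s t, u (s + t) 0 2 = u t 0 2 + u s 0 1 * u t 1 2 + u s 0 2 := fun s t => by
    rw [hadd']
    simp [unitri, Matrix.mul_apply, Fin.sum_univ_three]
  obtain ⟨y, z, -, hyz, -⟩ := weyl_entries hm hψ hℓ (hshape 1)
  have hγ : u 1 0 2 ≠ 0 := by
    intro h
    rw [h, zero_mul, zero_mul] at hyz
    simp at hyz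
  have hmono : ∀ i j n, (![(m : ℤ), 0, -m] : Fin 3 → ℤ) i - (![(m : ℤ), 0, -m] : Fin 3 → ℤ) j = n →
      (∀ t, u t i j = 0) ∨ (u 1 i j ≠ 0 ∧ ∃ l : ℕ, n = 2 * l ∧ ∀ t, u t i j = u 1 i j * t ^ l) := by
    intro i j n hn
    by_cases h0 : u 1 i j = 0
    · left
      rcases unip_entry hφ hℓ i j with h | ⟨l, -, h⟩
      · exact h
      · intro t
        change (φ (unip k t)).1 i j = 0
        rw [h]
        exact mul_eq_zero_of_left h0 _
    · right
      rcases unip_entry hφ hℓ i j with h | ⟨l, hl, h⟩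
      · exact absurd (h 1) h0
      · exact ⟨h0, l, hn ▸ hl, h⟩
  have h02 : ∀ t, u t 0 2 = u 1 0 2 * t ^ m := by
    rcases hmono 0 2 (2 * m) (by simp; ring) with h | ⟨-, l, hl, h⟩
    · exact absurd (h 1) hγ
    · obtain rfl : m = l := by omega
      exact h
  have hprime : ∀ {c : k} {l : ℕ}, c ≠ 0 → m = 2 * l →
      (∀ t, c * (1 + t) ^ l = c * t ^ l + c * 1 ^ l) → ∃ e, l = p ^ e := by
    intro c l hc hl h
    refine exists_eq_pow_of_additive (k := k) hp (by omega) fun t => mul_left_cancel₀ hc ?_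
    rw [h t]
    ring
  have hconj : ∀ {M : k → Matrix (Fin 3) (Fin 3) k} {D : Fin 3 → k},
      (∀ t i j, unitri (u t 0 1) (u t 1 2) (u t 0 2) i j * D j = D i * M t i j) →
      ∀ t, u t * Matrix.diagonal D = Matrix.diagonal D * M t := by
    intro M D h t
    ext i j
    rw [Matrix.mul_diagonal, Matrix.diagonal_mul, ← h, ← hshape]
  have htwo : (2 : k) = 0 → p = 2 := by
    intro h
    have h1 : p ∣ 2 := (CharP.cast_eq_zero_iff k p 2).1 (by exact_mod_cast h)
    exact (Nat.prime_dvd_prime_iff_eq hp Nat.prime_two).1 h1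
  -- the mixed term of the additivity relation at `s = t = 1`
  have hmix : ∀ l : ℕ, m = 2 * l → (∃ e, l = p ^ e) →
      2 * u 1 0 2 = u 1 0 1 * u 1 1 2 := by
    rintro _ hl ⟨e, rfl⟩
    have : ExpChar k p := ExpChar.prime hp
    have h1 := hadd02 1 1
    -- By Frobenius `(1 + 1) ^ (2 * p ^ e) = 4` in `k`, so additivity reads `4γ = 2γ + αβ`.
    rw [h02 (1 + 1), hl, mul_comm 2, pow_mul, add_pow_expChar_pow] at h1
    simp only [one_pow] at h1
    linear_combination h1
  rcases hmono 0 1 m (by simp) with hα | ⟨hα0, l, hl, hα⟩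
  · rcases hmono 1 2 m (by simp) with hβ | ⟨hβ0, l, hl, hβ⟩
    -- With α = 0 there is no mixed term: the corner itself is additive.
    · obtain ⟨e, rfl⟩ : ∃ e, m = p ^ e := by
        refine exists_eq_pow_of_additive (k := k) hp hm fun t => mul_left_cancel₀ hγ ?_
        have h1 := hadd02 1 t
        rw [hα, zero_mul, h02 (1 + t), h02 t] at h1
        rw [h1]
        ring
      refine ⟨.IV, hp.two_le, e, rfl, ![u 1 0 2, 1, 1], ?_, hconj fun t i j => ?_⟩
      · intro i
        fin_cases i <;> simp [hγ]
      · rw [h02 t, hα, hβ]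
        fin_cases i <;> fin_cases j <;> simp [unitri, SharpForm.matrix]
    · have hl' : m = 2 * l := by omega
      obtain ⟨e, rfl⟩ := hprime hβ0 hl' fun t => by rw [← hβ, ← hβ, ← hβ, hadd12]
      have h2 := hmix _ hl' ⟨e, rfl⟩
      rw [hα 1, zero_mul] at h2
      obtain rfl := htwo ((mul_eq_zero.1 h2).resolve_right hγ)
      refine ⟨.VII, rfl, e, hl'.symm, ![u 1 0 2, u 1 1 2, 1], ?_, hconj fun t i j => ?_⟩
      · intro i
        fin_cases i <;> simp [hγ, hβ0]
      · rw [h02 t, hα, hβ t]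
        fin_cases i <;> fin_cases j <;> simp [unitri, SharpForm.matrix, hl']
  · have hl' : m = 2 * l := by omega
    obtain ⟨e, rfl⟩ := hprime hα0 hl' fun t => by rw [← hα, ← hα, ← hα, hadd01]
    have h2 := hmix _ hl' ⟨e, rfl⟩
    rcases hmono 1 2 m (by simp) with hβ | ⟨hβ0, l', hl2, hβ⟩
    · rw [hβ 1, mul_zero] at h2
      obtain rfl := htwo ((mul_eq_zero.1 h2).resolve_right hγ)
      refine ⟨.V, rfl, e, hl'.symm, ![u 1 0 2, u 1 0 2 / u 1 0 1, 1], ?_, hconj fun t i j => ?_⟩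
      · intro i
        fin_cases i <;> simp [hγ, hα0]
      · rw [h02 t, hα t, hβ]
        fin_cases i <;> fin_cases j <;> simp [unitri, SharpForm.matrix, hl']
        field_simp
    · obtain rfl : l' = p ^ e := by omega
      have h20 : (2 : k) ≠ 0 := by
        intro h
        rw [h, zero_mul] at h2
        exact mul_ne_zero hα0 hβ0 h2.symm
      have hp3 : 3 ≤ p := by
        rcases hp.two_le.lt_or_eq with h | rfl
        · exact h
        · exact absurd (CharTwo.two_eq_zero (R := k)) h20
      -- With `D 2 = 1`, the last column dictates `D`; the 2 offsets the `1/2` in form I. The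
      -- `(0,1)` entry then agrees because `2γ = αβ`.
      refine ⟨.I, hp3, e, hl'.symm, ![2 * u 1 0 2, u 1 1 2, 1], ?_, hconj fun t i j => ?_⟩
      · intro i
        fin_cases i <;> simp [hγ, hβ0, h20]
      · rw [h02 t, hα t, hβ t]
        fin_cases i <;> fin_cases j <;> simp [unitri, SharpForm.matrix, hl']
        · linear_combination (-t ^ p ^ e) * h2
        · field_simp

theorem exists_equivalent_form {p : ℕ} (hp : p.Prime) [CharP k p] (hφ : IsFundamental φ) :
    ∃ lam : SharpForm, ∃ φ' ∈ R k p lam, Equivalent φ φ' := by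
  obtain ⟨hrep, ψ, -, hψ⟩ := hφ
  obtain ⟨P, ℓ, hℓ, hanti⟩ := exists_conj_hasWeights hrep
  have hψ' : ((conjSL P).comp ψ).comp (iota k) = (conjSL P).comp φ := by
    rw [MonoidHom.comp_assoc, hψ]
  have hrep' := hrep.conj P
  suffices h : ∃ lam : SharpForm, lam.Admissible p ∧ ∃ e, ∃ φ' : GaGm k →* _,
      IsGivenBy p e lam φ' ∧ Equivalent ((conjSL P).comp φ) φ' by
    obtain ⟨lam, hlam, e, φ', hφ', heq⟩ := h
    obtain ⟨φ₁, h1, h2, ψ₁, h3, -⟩ := exists_isGivenBy (k := k) hp lam hlam e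
    obtain rfl := h1.unique hφ'
    exact ⟨lam, φ₁, ⟨⟨h2, ψ₁, h3⟩, hlam, e, h1⟩, (equivalent_conj φ P).trans heq⟩
  generalize (conjSL P).comp φ = φ₁ at hψ' hrep' hℓ
  generalize (conjSL P).comp ψ = ψ₁ at hψ'
  obtain ⟨m, rfl⟩ := exists_weights_eq hψ' hℓ hanti
  by_cases hm : m = 0
  · subst hm
    have h1 : φ₁ = 1 := eq_one_of_weights_zero hrep' (by
      convert hℓ using 1
      funext i
      fin_cases i <;> simp)
    -- The exponent 0 is arbitrary: XII does not depend on it.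
    refine ⟨.XII, hp.two_le, 0, φ₁, fun g => ?_, Equivalent.refl _⟩
    rw [h1]
    exact Matrix.one_fin_three
  · obtain ⟨lam, hlam, e, rfl, D, hD, hconj⟩ := exists_form_unip hp hrep' hψ' hm hℓ
    obtain ⟨φ', h1, -⟩ := exists_isGivenBy (k := k) hp lam hlam e
    have hunit : IsUnit (Matrix.diagonal D) := by
      rw [Matrix.isUnit_diagonal, Pi.isUnit_iff]
      exact fun i => (hD i).isUnit
    obtain ⟨Q, hQ⟩ := hunit
    refine ⟨lam, hlam, e, φ', h1, equivalent_of_intertwine Q fun g => ?_⟩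
    have h2 : (φ₁ (SemidirectProduct.inr g.right)).1 = _ := hℓ g.right
    -- Diagonal `D` commutes with the torus, so intertwining the unipotent parts suffices.
    rw [eq_unip_mul_inr g, h1.apply, map_mul, Matrix.SpecialLinearGroup.coe_mul, hQ,
      ← Matrix.mul_assoc, ← hconj, h2, Matrix.mul_assoc, Matrix.mul_assoc,
      Matrix.diagonal_mul_diagonal, Matrix.diagonal_mul_diagonal]
    simp only [mul_comm]

end Classification

/-! ### Equivalence between the forms. -/

section Comparison

variable {k : Type*} [Field k] [IsAlgClosed k] {p : ℕ}
  {φ ψ : GaGm k →* SpecialLinearGroup (Fin 3) k} {lam mu : SharpForm} {e f : ℕ}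

/-- Row 0 and column 0 of an intertwiner are nonzero, so each highest weight occurs among the
weights of the other side. -/
theorem weight_eq_of_equivalent_torusPart (hφ : IsGivenBy p e lam φ) (hψ : IsGivenBy p f mu ψ)
    (h : Equivalent (torusPart φ) (torusPart ψ)) : lam.weight p e = mu.weight p f := by
  obtain ⟨P, hP⟩ := h.exists_intertwine
  have hdet : P.1.det ≠ 0 := ((Matrix.isUnit_iff_isUnit_det _).1 P.isUnit).ne_zero
  obtain ⟨j, hj⟩ : ∃ j, P.1 0 j ≠ 0 := by
    by_contra! h0
    exact hdet (Matrix.det_eq_zero_of_row_eq_zero 0 h0)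
  obtain ⟨i, hi⟩ : ∃ i, P.1 i 0 ≠ 0 := by
    by_contra! h0
    exact hdet (Matrix.det_eq_zero_of_column_eq_zero 0 h0)
  have h1 := hφ.hasWeights.weight_eq_of_intertwine hψ.hasWeights hP hj
  have h2 := hφ.hasWeights.weight_eq_of_intertwine hψ.hasWeights hP hi
  fin_cases i <;> fin_cases j <;> simp at h1 h2 <;> omega

theorem form_eq_of_equivalent (hp : p.Prime) (hφ : IsGivenBy p e lam φ)
    (hψ : IsGivenBy p f mu ψ) (h : Equivalent φ ψ) : lam = mu := by
  have hw := weight_eq_of_equivalent_torusPart hφ hψ h.torusPart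
  by_cases hm : lam.weight p e = 0
  · replace hw := hw.symm.trans hm
    cases lam <;> simp [SharpForm.weight, hp.ne_zero] at hm
    cases mu <;> simp [SharpForm.weight, hp.ne_zero] at hw
    rfl
  · obtain ⟨P, hP⟩ := h.exists_intertwine
    have hdet : P.1.det ≠ 0 := ((Matrix.isUnit_iff_isUnit_det _).1 P.isUnit).ne_zero
    have hdiag : ∀ i j, i ≠ j → P.1 i j = 0 := by
      intro i j hij
      by_contra hne
      have h1 := hφ.hasWeights.weight_eq_of_intertwine hψ.hasWeights (fun z => hP _) hne
      rw [← hw] at h1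
      fin_cases i <;> fin_cases j <;> simp at hij h1 <;> omega
    have hP' : P.1 = Matrix.diagonal fun i => P.1 i i := by
      ext i j
      rcases eq_or_ne i j with rfl | hij
      · simp
      · rw [hdiag i j hij, Matrix.diagonal_apply_ne _ hij]
    generalize (fun i => P.1 i i) = d at hP'
    have hd : ∀ i, d i ≠ 0 := by
      rw [hP', Matrix.det_diagonal] at hdet
      exact fun i => Finset.prod_ne_zero_iff.1 hdet i (Finset.mem_univ i)
    have hU := hP (unip k 1)
    rw [hφ.apply_unip, hψ.apply_unip, hP'] at hU
    -- Diagonal conjugation preserves zeros, and entries `(0,1)` and `(1,2)` tell I, IV, V, VII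
    -- apart.
    have hzero : ∀ i j, lam.matrix p e (1 : k) 1 1 i j = 0 ↔ mu.matrix p f (1 : k) 1 1 i j = 0 := by
      intro i j
      have h1 := congrFun (congrFun hU i) j
      rw [Matrix.mul_diagonal, Matrix.diagonal_mul] at h1
      rw [← mul_eq_zero_iff_right (hd j), h1, mul_eq_zero_iff_left (hd i)]
    have h01 := hzero 0 1
    have h12 := hzero 1 2
    cases lam <;> cases mu <;> first
      | rfl
      | exact absurd rfl hm
      | exact absurd hw hm
      | simp [SharpForm.matrix] at h01 h12

theorem tfae_of_isGivenBy (hp : p.Prime) (hφ : IsGivenBy p e lam φ) (hψ : IsGivenBy p f lam ψ)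
    {ℓ m : Fin 3 → ℤ} (hℓ : HasWeights (torusPart φ) ℓ) (hm : HasWeights (torusPart ψ) m) :
    [Equivalent φ ψ, Equivalent (torusPart φ) (torusPart ψ), ℓ = m, φ = ψ].TFAE := by
  obtain rfl := hℓ.unique hφ.hasWeights
  obtain rfl := hm.unique hψ.hasWeights
  tfae_have 1 → 2 := Equivalent.torusPart
  tfae_have 2 → 3 := fun h => by rw [weight_eq_of_equivalent_torusPart hφ hψ h]
  -- The weight determines `e`, except for XII, where `e` plays no role.
  tfae_have 3 → 4 := fun h => by
    have hw : lam.weight p e = lam.weight p f := by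
      simpa using congrFun h 0
    have hmat : ∀ a b d : k, lam.matrix p e a b d = lam.matrix p f a b d := by
      intro a b d
      cases lam
      case XII => rfl
      all_goals
        have hef : p ^ e = p ^ f := by
          simp only [SharpForm.weight] at hw
          omega
        obtain rfl := Nat.pow_right_injective hp.two_le hef
        rfl
    ext1 g
    refine Subtype.ext ?_
    rw [hφ g, hψ g]
    exact hmat _ _ _
  tfae_have 4 → 1 := fun h => h ▸ Equivalent.refl φ
  tfae_finish

end Comparison

end AlgRep

theorem theorem3p12 {k : Type*} [Field k] [IsAlgClosed k] (p : ℕ) (hp : p.Prime) [CharP k p] :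
    -- the forms define representations, each with a unique extension to `SL(2, k)`
    (∀ lam : AlgRep.SharpForm, lam.Admissible p → ∀ e : ℕ,
      ∃ φ : AlgRep.GaGm k →* Matrix.SpecialLinearGroup (Fin 3) k,
        AlgRep.IsGivenBy p e lam φ ∧ AlgRep.IsRep (AlgRep.coordGaGm k) φ ∧
          ∃! ψ : Matrix.SpecialLinearGroup (Fin 2) k →* Matrix.SpecialLinearGroup (Fin 3) k,
            AlgRep.IsExtension φ ψ) ∧
    -- every fundamental representation is equivalent to one of these forms
    (∀ φ : AlgRep.GaGm k →* Matrix.SpecialLinearGroup (Fin 3) k, AlgRep.IsFundamental φ →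
      ∃ lam : AlgRep.SharpForm, ∃ φ' ∈ AlgRep.R k p lam, AlgRep.Equivalent φ φ') ∧
    -- the weights exist; then non-equivalence and uniqueness
    (∀ lam : AlgRep.SharpForm, ∀ φ ∈ AlgRep.R k p lam,
      ∃ ℓ : Fin 3 → ℤ, AlgRep.HasWeights (AlgRep.torusPart φ) ℓ) ∧
    (∀ lam mu : AlgRep.SharpForm, ∀ φ ∈ AlgRep.R k p lam, ∀ ψ ∈ AlgRep.R k p mu,
      ∀ ℓ m : Fin 3 → ℤ, AlgRep.HasWeights (AlgRep.torusPart φ) ℓ →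
        AlgRep.HasWeights (AlgRep.torusPart ψ) m →
      (lam ≠ mu → ¬ AlgRep.Equivalent φ ψ) ∧
      (lam = mu →
        [AlgRep.Equivalent φ ψ,
          AlgRep.Equivalent (AlgRep.torusPart φ) (AlgRep.torusPart ψ),
          ℓ = m,
          φ = ψ].TFAE)) := by
  refine ⟨fun lam hlam e => AlgRep.exists_isGivenBy hp lam hlam e,
    fun φ hφ => AlgRep.exists_equivalent_form hp hφ,
    fun lam φ hφ => ?_, fun lam mu φ hφ ψ hψ ℓ m hℓ hm => ⟨fun hne heq => ?_, ?_⟩⟩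
  · obtain ⟨-, -, e, he⟩ := hφ
    exact ⟨_, he.hasWeights⟩
  · obtain ⟨-, -, e, he⟩ := hφ
    obtain ⟨-, -, f, hf⟩ := hψ
    exact hne (AlgRep.form_eq_of_equivalent hp he hf heq)
  · rintro rfl
    obtain ⟨-, -, e, he⟩ := hφ
    obtain ⟨-, -, f, hf⟩ := hψ
    exact AlgRep.tfae_of_isGivenBy hp he hf hℓ hm
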